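/- Throughout, a selfadjoint operator space is a norm-closed linear subspace $E\subseteq\mathcal B(H)$, $H$ a complex Hilbert space, with $x^*\in E$ for all $x\in E$. For every $n$ the space $M_n(E)\subseteq M_n(\mathcal B(H))=\mathcal B(H^n)$ carries the induced norm, involution and cone $M_n(E)_+$, and is itself a selfadjoint operator space. A linear map $\phi$ is completely contractive (completely isometric) if every amplification $\phi^{(n)}\colon[x_{ij}]\mapsto[\phi(x_{ij})]$ is contractive (isometric); it is completely positive if every $\phi^{(n)}$ commutes with the involution and maps positive elements to positive elements; it is a complete order embedding if it is completely positive and injective, with completely positive inverse on its image. $\mathrm{CCP}(M_n(E),\mathbb C)$ denotes the set of completely contractive completely positive maps $M_n(E)\to\mathbb C$. The unitisation of $E$ is the space $E^\#=E\oplus\mathbb C$ with the involution $(x,a)^*=(x^*,\overline a)$, in which a selfadjoint $(x,a)\in M_n(E^\#)$, $x\in M_n(E)$, $a\in M_n(\mathbb C)$, is called positive if $a\ge 0$ and $$\varphi\big((a+\varepsilon 1)^{-1/2}\,x\,(a+\varepsilon 1)^{-1/2}\big)\ge -1\quad\text{for all }\varepsilon>0\text{ and all }\varphi\in\mathrm{CCP}(M_n(E),\mathbb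 C).$$ A map $\theta\colon E\to F$ between selfadjoint operator spaces is called an embedding if it is a completely isometric complete order embedding and $\theta^\#\colon E^\#\to F^\#$, $(x,a)\mapsto(\theta(x),a)$, is a unital complete order embedding. The space $E$ is completely approximately $1$-generated if, for every $n$, every selfadjoint $x\in M_n(E)$ with $\|x\|\le1$ lies in the norm closure of $\{p-q : p,q\in M_n(E)_+,\ \|p\|\le1,\ \|q\|\le1\}$. **Theorem.** If $E$ is a completely approximately $1$-generated selfadjoint operator space, then $E$ has the automatic embedding property: every completely isometric complete order embedding $\theta\colon E\to F$ into a selfadjoint operator space $F$ is an embedding. -/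

import Mathlib

open scoped ComplexOrder Pointwise

universe u v

noncomputable section

/-- A norm-closed selfadjoint linear subspace of a C*-algebra `A`. For `A = H →L[ℂ] H`, the bounded
operators on a complex Hilbert space, this is a (concrete) selfadjoint operator space; general
ambient C*-algebras are allowed so that `M_n(E)` is again such an object. -/
structure SelfadjointOperatorSpace (A : Type*) [CStarAlgebra A] extends Submodule ℂ A where
  isClosed_carrier : IsClosed carrier
  star_mem_carrier : ∀ {x : A}, x ∈ carrier → star x ∈ carrier

namespace SelfadjointOperatorSpace

instance instSetLike {A : Type*} [CStarAlgebra A] : SetLike (SelfadjointOperatorSpace A) A where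
  coe E := E.carrier
  coe_injective E F h := by
    obtain ⟨E, _, _⟩ := E
    obtain ⟨F, _, _⟩ := F
    have : E = F := SetLike.coe_injective h
    subst this
    rfl

instance instAddSubgroupClass {A : Type*} [CStarAlgebra A] :
    AddSubgroupClass (SelfadjointOperatorSpace A) A where
  add_mem {E} _ _ hx hy := E.toSubmodule.add_mem hx hy
  zero_mem E := E.toSubmodule.zero_mem
  neg_mem {E} _ hx := E.toSubmodule.neg_mem hx

instance instSMulMemClass {A : Type*} [CStarAlgebra A] :
    SMulMemClass (SelfadjointOperatorSpace A) ℂ A where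
  smul_mem {E} c _ hx := E.toSubmodule.smul_mem c hx

instance instStarMemClass {A : Type*} [CStarAlgebra A] :
    StarMemClass (SelfadjointOperatorSpace A) A where
  star_mem {E} _ hx := E.star_mem_carrier hx

/-- The selfadjoint operator space `M_n(E)`: the matrices with entries in `E`, inside the C*-algebra
`M_n(A)`. For `A = B(H)` the C*-algebra `M_n(A)` is `B(Hⁿ)`, with its norm and order. -/
def mat {A : Type*} [CStarAlgebra A] [PartialOrder A] [StarOrderedRing A]
    (E : SelfadjointOperatorSpace A) (n : ℕ) :
    SelfadjointOperatorSpace (CStarMatrix (Fin n) (Fin n) A) where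
  carrier := {M | ∀ i j, M i j ∈ E}
  add_mem' hM hN i j := add_mem (hM i j) (hN i j)
  zero_mem' _ _ := zero_mem E
  smul_mem' c _ hM i j := SMulMemClass.smul_mem c (hM i j)
  isClosed_carrier := by
    have h : {M : CStarMatrix (Fin n) (Fin n) A | ∀ i j, M i j ∈ E} =
        ⋂ i, ⋂ j, (fun M : CStarMatrix (Fin n) (Fin n) A => M i j) ⁻¹' (E.carrier) := by
      ext M
      simp only [Set.mem_ofPred_eq, Set.mem_iInter, Set.mem_preimage]
      rfl
    rw [h]
    refine isClosed_iInter fun i => isClosed_iInter fun j => E.isClosed_carrier.preimage ?_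
    exact (continuous_apply j).comp
      (continuous_apply (A := fun _ : Fin n => Fin n → A) i)
  star_mem_carrier hM i j := star_mem (hM j i)

/-- `(E₊)_κ`, the positive elements of `E` of norm at most `κ`. -/
def posBall {A : Type*} [CStarAlgebra A] [PartialOrder A]
    (E : SelfadjointOperatorSpace A) (κ : ℝ) : Set E :=
  {p | 0 ≤ (p : A) ∧ ‖p‖ ≤ κ}

/-- `E` is completely approximately `κ`-generated: for every `n`, every selfadjoint element of the
closed unit ball of `M_n(E)` lies in the norm closure of `(M_n(E)₊)_κ - (M_n(E)₊)_κ`. -/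
def IsCompletelyApproximatelyGenerated {A : Type*} [CStarAlgebra A] [PartialOrder A]
    [StarOrderedRing A] (E : SelfadjointOperatorSpace A) (κ : ℝ) : Prop :=
  ∀ (n : ℕ) (x : E.mat n), IsSelfAdjoint x → ‖x‖ ≤ 1 →
    x ∈ closure ((E.mat n).posBall κ - (E.mat n).posBall κ)

end SelfadjointOperatorSpace

/-- The distinguished cones `M_n(V)₊` of a matrix ordered space. -/
class MatrixCone (V : Type*) where
  cone : ∀ n : ℕ, Set (Matrix (Fin n) (Fin n) V)

/-- The distinguished norms on `M_n(V)`. -/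
class MatrixNorm (V : Type*) where
  matNorm : ∀ {n : ℕ}, Matrix (Fin n) (Fin n) V → ℝ

/-- The matrix cones of `E ⊆ A` are inherited from the C*-algebras `M_n(A)`. -/
instance SelfadjointOperatorSpace.instMatrixCone {A : Type*} [CStarAlgebra A] [PartialOrder A]
    [StarOrderedRing A] (E : SelfadjointOperatorSpace A) : MatrixCone E where
  cone n := {X | 0 ≤ (CStarMatrix.ofMatrix fun i j => (X i j : A) :
    CStarMatrix (Fin n) (Fin n) A)}

/-- The matrix norms of `E ⊆ A` are inherited from the C*-algebras `M_n(A)`. -/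
instance SelfadjointOperatorSpace.instMatrixNorm {A : Type*} [CStarAlgebra A] [PartialOrder A]
    [StarOrderedRing A] (E : SelfadjointOperatorSpace A) : MatrixNorm E where
  matNorm {n} X := ‖(CStarMatrix.ofMatrix fun i j => (X i j : A) :
    CStarMatrix (Fin n) (Fin n) A)‖

/-- The positive semidefinite cones in `M_n(ℂ)`. -/
instance Complex.instMatrixCone : MatrixCone ℂ where
  cone n := {X | 0 ≤ (CStarMatrix.ofMatrix X : CStarMatrix (Fin n) (Fin n) ℂ)}

/-- The C*-norms (operator norms) on `M_n(ℂ)`. -/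
instance Complex.instMatrixNorm : MatrixNorm ℂ where
  matNorm {n} X := ‖(CStarMatrix.ofMatrix X : CStarMatrix (Fin n) (Fin n) ℂ)‖

/-- Complete positivity: every amplification `φ⁽ⁿ⁾ = (X ↦ X.map φ)` is selfadjoint and maps the cone
of `M_n(V)` into the cone of `M_n(W)`. -/
def IsCompletelyPositive {V W : Type*} [AddCommMonoid V] [Module ℂ V] [Star V] [MatrixCone V]
    [AddCommMonoid W] [Module ℂ W] [Star W] [MatrixCone W] (φ : V →ₗ[ℂ] W) : Prop :=
  ∀ n : ℕ, (∀ X : Matrix (Fin n) (Fin n) V, X.conjTranspose.map φ = (X.map φ).conjTranspose) ∧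
    ∀ X ∈ MatrixCone.cone (V := V) n, X.map φ ∈ MatrixCone.cone (V := W) n

/-- Complete contractivity: `‖φ⁽ⁿ⁾(X)‖ ≤ ‖X‖` for all `n` and `X ∈ M_n(V)`. -/
def IsCompletelyContractive {V W : Type*} [AddCommMonoid V] [Module ℂ V] [MatrixNorm V]
    [AddCommMonoid W] [Module ℂ W] [MatrixNorm W] (φ : V →ₗ[ℂ] W) : Prop :=
  ∀ (n : ℕ) (X : Matrix (Fin n) (Fin n) V),
    MatrixNorm.matNorm (X.map φ) ≤ MatrixNorm.matNorm X

/-- `CCP(V, W)`: the completely contractive completely positive maps. -/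
def CCP (V W : Type*) [AddCommMonoid V] [Module ℂ V] [Star V] [MatrixCone V] [MatrixNorm V]
    [AddCommMonoid W] [Module ℂ W] [Star W] [MatrixCone W] [MatrixNorm W] : Set (V →ₗ[ℂ] W) :=
  {φ | IsCompletelyContractive φ ∧ IsCompletelyPositive φ}

/-- Completely isometric: `‖φ⁽ⁿ⁾(X)‖ = ‖X‖` for all `n` and `X ∈ M_n(V)`. -/
def IsCompletelyIsometric {V W : Type*} [AddCommMonoid V] [Module ℂ V] [MatrixNorm V]
    [AddCommMonoid W] [Module ℂ W] [MatrixNorm W] (φ : V →ₗ[ℂ] W) : Prop :=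
  ∀ (n : ℕ) (X : Matrix (Fin n) (Fin n) V),
    MatrixNorm.matNorm (X.map φ) = MatrixNorm.matNorm X

/-- Complete order embedding: `φ` is completely positive, injective, and its inverse on the image is
completely positive (that inverse is selfadjoint because `φ` is, so only the cones have to be
mentioned). -/
def IsCompleteOrderEmbedding {V W : Type*} [AddCommMonoid V] [Module ℂ V] [Star V] [MatrixCone V]
    [AddCommMonoid W] [Module ℂ W] [Star W] [MatrixCone W] (φ : V →ₗ[ℂ] W) : Prop :=
  IsCompletelyPositive φ ∧ Function.Injective φ ∧
    ∀ (n : ℕ) (X : Matrix (Fin n) (Fin n) V),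
      X.map φ ∈ MatrixCone.cone (V := W) n → X ∈ MatrixCone.cone (V := V) n

namespace SelfadjointOperatorSpace

/-- The scalar compression `α x β ∈ M_n(E)` for `α, β ∈ M_n(ℂ)` and `x ∈ M_n(E)`. -/
def scalarMul {A : Type*} [CStarAlgebra A] [PartialOrder A] [StarOrderedRing A]
    (E : SelfadjointOperatorSpace A) {n : ℕ} (α : CStarMatrix (Fin n) (Fin n) ℂ)
    (x : Matrix (Fin n) (Fin n) E) (β : CStarMatrix (Fin n) (Fin n) ℂ) : E.mat n :=
  ⟨CStarMatrix.ofMatrix fun i j => ((∑ k, ∑ l, (α i k * β l j) • x k l : E) : A),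
    fun _ _ => SetLike.coe_mem _⟩

/-- `a^{-1/2}` for a positive invertible `a` in a unital C*-algebra, by functional calculus. -/
def invSqrt {A : Type*} [CStarAlgebra A] [PartialOrder A] [StarOrderedRing A] (a : A) : A :=
  a ^ (-(1 / 2) : ℝ)

/-- The underlying vector space of Werner's unitisation `E^# = E ⊕ ℂ`, with the involution
`(x, a)* = (x*, conj a)`. -/
abbrev Unitisation {A : Type*} [CStarAlgebra A] (E : SelfadjointOperatorSpace A) : Type _ :=
  E × ℂ

/-- The matrix cones of `E^#`: a selfadjoint `X = (x, a)` with `x ∈ M_n(E)`, `a ∈ M_n(ℂ)` is positive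
if `a ≥ 0` and `φ(a_ε^{-1/2} x a_ε^{-1/2}) ≥ -1` for all `ε > 0` and `φ ∈ CCP(M_n(E), ℂ)`, where
`a_ε = a + ε 1`. (The value of `φ` here is real, as `φ` and its argument are selfadjoint.) -/
instance instMatrixConeUnitisation {A : Type*} [CStarAlgebra A] [PartialOrder A]
    [StarOrderedRing A] (E : SelfadjointOperatorSpace A) : MatrixCone E.Unitisation where
  cone n := {X | X.IsHermitian ∧
    let x : Matrix (Fin n) (Fin n) E := X.map Prod.fst
    let a : CStarMatrix (Fin n) (Fin n) ℂ := CStarMatrix.ofMatrix (X.map Prod.snd)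
    0 ≤ a ∧ ∀ ε : ℝ, 0 < ε → ∀ φ ∈ CCP (E.mat n) ℂ,
      -1 ≤ (φ (E.scalarMul (invSqrt (a + (ε : ℂ) • 1)) x (invSqrt (a + (ε : ℂ) • 1)))).re}

/-- The unitisation `θ^# : E^# → F^#`, `(x, a) ↦ (θ x, a)`, of a linear map `θ : E → F`. -/
def unitisationMap {A B : Type*} [CStarAlgebra A] [CStarAlgebra B]
    {E : SelfadjointOperatorSpace A} {F : SelfadjointOperatorSpace B} (θ : E →ₗ[ℂ] F) :
    E.Unitisation →ₗ[ℂ] F.Unitisation :=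
  LinearMap.prodMap θ LinearMap.id

/-- `θ` is an embedding: it is a completely isometric complete order embedding, and its unitisation
`θ^#` is a unital complete order embedding. -/
def IsEmbedding {A B : Type*} [CStarAlgebra A] [PartialOrder A] [StarOrderedRing A]
    [CStarAlgebra B] [PartialOrder B] [StarOrderedRing B]
    {E : SelfadjointOperatorSpace A} {F : SelfadjointOperatorSpace B} (θ : E →ₗ[ℂ] F) : Prop :=
  IsCompletelyIsometric θ ∧ IsCompleteOrderEmbedding θ ∧
    unitisationMap θ (0, 1) = (0, 1) ∧ IsCompleteOrderEmbedding (unitisationMap θ)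

/-- The automatic embedding property: every completely isometric complete order embedding of `E` into
a selfadjoint operator space `F ⊆ B(K)`, `K` any complex Hilbert space, is an embedding. -/
def AutomaticEmbeddingProperty {A : Type u} [CStarAlgebra A] [PartialOrder A]
    [StarOrderedRing A] (E : SelfadjointOperatorSpace A) : Prop :=
  ∀ (K : Type v) [NormedAddCommGroup K] [InnerProductSpace ℂ K] [CompleteSpace K]
    (F : SelfadjointOperatorSpace (K →L[ℂ] K)) (θ : E →ₗ[ℂ] F),
    IsCompletelyIsometric θ → IsCompleteOrderEmbedding θ → IsEmbedding θ

end SelfadjointOperatorSpace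

end

/-! Positivity in `E^#` is tested by quasistates, the elements of `CCP (E.mat n) ℂ`. Those of
`M_n(F)` pull back along `θ⁽ⁿ⁾`, so `θ^#` is always completely positive; its inverse on the image is
too once every quasistate of `M_n(E)` extends along `θ⁽ⁿ⁾` (`isEmbedding_of_extension`). To extend
`φ` (`exists_mem_CCP_extension`), take a norm-preserving Hahn–Banach extension `f` to the ambient
C*-algebra. If `p` is a positive contraction in `M_n(E)`, its image `b` satisfies `‖2b - 1‖ ≤ 1`, so
`2 Re φ(p) ≤ ‖f‖ + Re f(1)`. By 1-generation such `p` determine `‖φ‖ = ‖f‖`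
(`norm_apply_le_of_forall_posBall`), whence `‖f‖ ≤ Re f(1)`, which forces `f` to be positive up to
taking its hermitian part. -/

lemma CStarAlgebra.exists_eq_star_mul_self {B : Type*} [CStarAlgebra B] [PartialOrder B]
    [StarOrderedRing B] {b : B} (hb : 0 ≤ b) : ∃ c, b = star c * c :=
  CStarAlgebra.nonneg_iff_eq_star_mul_self.mp hb

/-! ### Scalar compressions of matrices: norm and positivity. -/

namespace CStarMatrix

open WithCStarModule

/-- The scalar compression `∑ᵢⱼ vᵢ w̄ⱼ Mᵢⱼ` of a matrix by two vectors. -/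
def compression {ι V : Type*} [Fintype ι] [AddCommMonoid V] [Module ℂ V]
    (M : Matrix ι ι V) (v w : ι → ℂ) : V :=
  ∑ i, ∑ j, (v i * star (w j)) • M i j

lemma map_compression {ι V W : Type*} [Fintype ι] [AddCommMonoid V] [Module ℂ V]
    [AddCommMonoid W] [Module ℂ W] (φ : V →ₗ[ℂ] W) (M : Matrix ι ι V) (v w : ι → ℂ) :
    φ (compression M v w) = compression (M.map φ) v w := by
  simp [compression, map_sum]

variable {ι : Type*} [Fintype ι] {A : Type*} [CStarAlgebra A] [PartialOrder A]
  [StarOrderedRing A]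

lemma norm_scalarVector_le (v : ι → ℂ) :
    ‖(equiv A (ι → A)).symm fun i => v i • (1 : A)‖ ≤ √(∑ i, ‖v i‖ ^ 2) := by
  rw [pi_norm]
  apply Real.sqrt_le_sqrt
  refine (norm_sum_le _ _).trans (Finset.sum_le_sum fun i _ => ?_)
  simp only [equiv_symm_pi_apply, inner_def, star_smul, star_one, smul_mul_smul_comm, mul_one]
  -- In the zero algebra `‖1‖ = 0`, so only an inequality holds in general.
  rcases subsingleton_or_nontrivial A with h | h
  · simp [Subsingleton.elim (1 : A) 0]
  · simp [norm_smul, sq]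

/-- The compression is the inner product of `M v` with `w` in the Hilbert module `Aⁿ`, for vectors
with entries in `ℂ · 1`; Cauchy–Schwarz applies. -/
lemma norm_compression_le (M : CStarMatrix ι ι A) (v w : ι → ℂ) :
    ‖compression (ofMatrix.symm M) v w‖ ≤ ‖M‖ * √(∑ i, ‖v i‖ ^ 2) * √(∑ i, ‖w i‖ ^ 2) := by
  set v' : C⋆ᵐᵒᵈ(A, ι → A) := (equiv A (ι → A)).symm fun i => v i • (1 : A)
  set w' : C⋆ᵐᵒᵈ(A, ι → A) := (equiv A (ι → A)).symm fun i => w i • (1 : A)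
  have h : compression (ofMatrix.symm M) v w = inner A w' (toCLM M v') := by
    rw [toCLM_apply_eq_sum, pi_inner, compression, Finset.sum_comm]
    refine Finset.sum_congr rfl fun j _ => ?_
    simp only [v', w', equiv_symm_pi_apply, inner_def, Finset.sum_mul]
    refine Finset.sum_congr rfl fun i _ => ?_
    simp [smul_smul, mul_comm]
  rw [h]
  calc _ ≤ ‖w'‖ * ‖toCLM M v'‖ := CStarModule.norm_inner_le _
    _ ≤ ‖w'‖ * (‖M‖ * ‖v'‖) := by
      gcongr
      exact (toCLM M).le_opNorm v'
    _ ≤ √(∑ i, ‖w i‖ ^ 2) * (‖M‖ * √(∑ i, ‖v i‖ ^ 2)) := by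
      gcongr <;> exact norm_scalarVector_le _
    _ = _ := by ring

/-- Factoring `M = B* B` turns the compression into a sum of squares `∑ₖ rₖ* rₖ`, one for each row
of `B`. -/
lemma compression_nonneg [DecidableEq ι] {M : CStarMatrix ι ι A} (hM : 0 ≤ M) (v : ι → ℂ) :
    0 ≤ compression (ofMatrix.symm M) v v := by
  obtain ⟨B, rfl⟩ := CStarAlgebra.exists_eq_star_mul_self hM
  have h : compression (ofMatrix.symm (star B * B)) v v =
      ∑ k, star (∑ j, star (v j) • B k j) * ∑ j, star (v j) • B k j := by
    simp only [compression, ofMatrix_symm_apply, mul_apply, star_apply, star_sum, star_smul,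
      star_star, Finset.sum_mul_sum, Finset.smul_sum, smul_mul_smul_comm]
    rw [Finset.sum_congr rfl fun i _ => Finset.sum_comm, Finset.sum_comm]
  rw [h]
  exact Finset.sum_nonneg fun k _ => star_mul_self_nonneg _

lemma norm_le_of_compression_le {M : CStarMatrix ι ι ℂ} {C : ℝ} (hC : 0 ≤ C)
    (h : ∀ v w : ι → ℂ,
      ‖compression (ofMatrix.symm M) v w‖ ≤ C * √(∑ i, ‖v i‖ ^ 2) * √(∑ i, ‖w i‖ ^ 2)) :
    ‖M‖ ≤ C := by
  lift C to NNReal using hC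
  refine norm_le_of_forall_inner_le fun v w => ?_
  have hn : ∀ u : C⋆ᵐᵒᵈ(ℂ, ι → ℂ), ‖u‖ = √(∑ i, ‖u i‖ ^ 2) := fun u => by
    have : ∑ i, inner ℂ (u i) (u i) = ((∑ i, ‖u i‖ ^ 2 : ℝ) : ℂ) := by
      push_cast
      refine Finset.sum_congr rfl fun i _ => ?_
      exact Complex.mul_conj' _
    rw [pi_norm, this, Complex.norm_real, Real.norm_of_nonneg (by positivity)]
  have hi : inner ℂ w (toCLM M v) = compression (ofMatrix.symm M) v w := by
    rw [toCLM_apply_eq_sum, pi_inner]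
    refine Eq.trans ?_ Finset.sum_comm
    refine Finset.sum_congr rfl fun j _ => ?_
    simp only [equiv_symm_pi_apply, inner_def, Finset.sum_mul]
    refine Finset.sum_congr rfl fun i _ => ?_
    simp
    ring
  rw [hi, hn v, hn w]
  exact h v w

/-- A factorisation `B* B` found in the Loewner order also witnesses positivity in the C*-order. -/
lemma nonneg_of_posSemidef {M : Matrix ι ι ℂ} (hM : M.PosSemidef) :
    (0 : CStarMatrix ι ι ℂ) ≤ ofMatrix M := by
  classical
  open scoped MatrixOrder in
  obtain ⟨B, rfl⟩ := CStarAlgebra.nonneg_iff_eq_star_mul_self.mp hM.nonneg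
  exact star_mul_self_nonneg (ofMatrix B)

lemma posSemidef_of_compression_nonneg {M : Matrix ι ι ℂ} (hM : M.IsHermitian)
    (h : ∀ v, 0 ≤ compression M v v) : M.PosSemidef := by
  refine .of_dotProduct_mulVec_nonneg hM fun x => ?_
  convert h (star x) using 1
  simp only [dotProduct, Matrix.mulVec, compression, Finset.mul_sum]
  refine Finset.sum_congr rfl fun i _ => Finset.sum_congr rfl fun j _ => ?_
  simp
  ring

variable (A) in
/-- The embedding of `A` as the `1 × 1` matrices over `A`. -/
def oneByOne : A →⋆ₙₐ[ℂ] CStarMatrix (Fin 1) (Fin 1) A where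
  toFun a := ofMatrix fun _ _ => a
  map_smul' _ _ := rfl
  map_zero' := rfl
  map_add' _ _ := rfl
  map_mul' a b := by
    ext i j
    simp only [mul_apply, Finset.univ_unique, Finset.sum_singleton]
    rfl
  map_star' _ := rfl

lemma norm_oneByOne_le (a : A) : ‖oneByOne A a‖ ≤ ‖a‖ :=
  NonUnitalStarAlgHom.norm_apply_le (oneByOne A) a

lemma oneByOne_nonneg {a : A} (ha : 0 ≤ a) : 0 ≤ oneByOne A a := by
  obtain ⟨b, rfl⟩ := CStarAlgebra.exists_eq_star_mul_self ha
  rw [map_mul, map_star]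
  exact star_mul_self_nonneg _

end CStarMatrix

/-! ### Quasistates and their extension. -/

namespace SelfadjointOperatorSpace

open CStarMatrix

variable {A : Type*} [CStarAlgebra A] [PartialOrder A] [StarOrderedRing A]

omit [PartialOrder A] [StarOrderedRing A] in
lemma coe_compression (V : SelfadjointOperatorSpace A) {n : ℕ} (X : Matrix (Fin n) (Fin n) V)
    (v w : Fin n → ℂ) :
    ((compression X v w : V) : A) = compression (X.map ((↑) : V → A)) v w :=
  map_compression (V.toSubmodule.subtype) X v w

/-- On functionals, complete positivity and complete contractivity are automatic. -/
theorem mem_CCP_iff (V : SelfadjointOperatorSpace A) (φ : V →ₗ[ℂ] ℂ) :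
    φ ∈ CCP V ℂ ↔ (∀ x, ‖φ x‖ ≤ ‖x‖) ∧ (∀ x, φ (star x) = star (φ x)) ∧
      ∀ x : V, 0 ≤ (x : A) → 0 ≤ φ x := by
  constructor
  · rintro ⟨hc, hp⟩
    refine ⟨fun x => ?_, fun x => ?_, fun x hx => ?_⟩
    · have h : ‖(ofMatrix fun _ _ => φ x : CStarMatrix (Fin 1) (Fin 1) ℂ)‖ ≤
          ‖oneByOne A (x : A)‖ := hc 1 (Matrix.of fun _ _ => x)
      exact (norm_entry_le_norm (i := 0) (j := 0)).trans (h.trans (norm_oneByOne_le _))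
    · exact congrFun (congrFun ((hp 1).1 (Matrix.of fun _ _ => x)) 0) 0
    · have h : (0 : CStarMatrix (Fin 1) (Fin 1) ℂ) ≤ ofMatrix fun _ _ => φ x :=
        (hp 1).2 (Matrix.of fun _ _ => x) (oneByOne_nonneg hx)
      have h1 := compression_nonneg h fun _ => 1
      simp only [compression, Finset.univ_unique, Finset.sum_singleton, star_one, mul_one,
        one_smul] at h1
      exact h1
  · rintro ⟨hc, hs, hp⟩
    refine ⟨fun n X => ?_, fun n => ⟨fun X => ?_, fun X hX => ?_⟩⟩
    -- By linearity, compressing `φ⁽ⁿ⁾(X)` is the same as applying `φ` to a compression of `X`; this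
    -- reduces both the norm and the positivity claim to level one.
    · refine norm_le_of_compression_le (norm_nonneg _) fun v w => ?_
      change ‖compression (X.map φ) v w‖ ≤ _
      rw [← map_compression]
      refine (hc _).trans ?_
      change ‖((compression X v w : V) : A)‖ ≤ _
      rw [coe_compression]
      exact norm_compression_le (ofMatrix (X.map ((↑) : V → A))) v w
    · ext i j
      exact hs (X j i)
    · have hc' : ∀ v, 0 ≤ compression (X.map φ) v v := fun v => by
        rw [← map_compression]
        refine hp _ ?_
        rw [coe_compression]
        exact compression_nonneg hX v
      have hX' : X.IsHermitian := by
        have h := (IsSelfAdjoint.of_nonneg (show (0 : CStarMatrix (Fin n) (Fin n) A) ≤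
          ofMatrix fun i j => (X i j : A) from hX)).star_eq
        ext i j
        exact congrFun (congrFun h i) j
      refine nonneg_of_posSemidef (posSemidef_of_compression_nonneg ?_ hc')
      ext i j
      have := congrFun (congrFun hX' i) j
      simp only [Matrix.conjTranspose_apply, Matrix.map_apply] at this ⊢
      rw [← hs, this]

/-- If the selfadjoint unit ball of `V` is approximated by differences of positive contractions,
then the norm of a positive functional is determined by its values on positive contractions. -/
lemma norm_apply_le_of_forall_posBall {V : SelfadjointOperatorSpace A}
    (hV : ∀ x : V, IsSelfAdjoint x → ‖x‖ ≤ 1 → x ∈ closure (V.posBall 1 - V.posBall 1))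
    {φ : V →ₗ[ℂ] ℂ} (hφ : φ ∈ CCP V ℂ) {C : ℝ} (hC : ∀ p ∈ V.posBall 1, (φ p).re ≤ C) (x : V) :
    ‖φ x‖ ≤ C * ‖x‖ := by
  obtain ⟨hc, hs, hp⟩ := (mem_CCP_iff V φ).mp hφ
  have hcont : Continuous φ := AddMonoidHomClass.continuous_of_bound φ 1 (by simpa using hc)
  -- On a difference, `Re φ(p - q) ≤ Re φ(p) ≤ C`, since `φ(q) ≥ 0`; this passes to the closure by
  -- continuity.
  have hsa : ∀ y : V, IsSelfAdjoint y → ‖y‖ ≤ 1 → (φ y).re ≤ C := fun y hy hy1 => by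
    have hcl : IsClosed {y : V | (φ y).re ≤ C} :=
      isClosed_le (Complex.continuous_re.comp hcont) continuous_const
    refine closure_minimal ?_ hcl (hV y hy hy1)
    rintro _ ⟨p, hpp, q, hq, rfl⟩
    have h0 := (Complex.le_def.mp (hp q hq.1)).1
    have h1 := hC p hpp
    simp only [Set.mem_ofPred_eq, map_sub, Complex.sub_re, Complex.zero_re] at h0 ⊢
    linarith
  have hball : ∀ y : V, ‖y‖ ≤ 1 → ‖φ y‖ ≤ C := fun y hy => by
    -- Rotating `y` by a phase makes `φ` take the value `‖φ y‖`; the selfadjoint part of the rotated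
    -- element then has the same value, as `φ` is hermitian.
    obtain ⟨c, hc1, hcy⟩ := Complex.exists_norm_mul_eq_self (φ y)
    have hc0 : star c * c = 1 := by
      have := Complex.normSq_eq_conj_mul_self (z := c)
      rw [Complex.normSq_eq_norm_sq, hc1] at this
      simpa using this.symm
    have hφc : φ (star c • y) = ‖φ y‖ := by
      rw [map_smul, smul_eq_mul]
      nth_rewrite 1 [← hcy]
      rw [← mul_assoc, hc0, one_mul]
    have hz : φ ((1 / 2 : ℂ) • (star c • y + star (star c • y))) = ‖φ y‖ := by
      rw [map_smul, map_add, hs, hφc]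
      simp
      ring
    have hcyn : ‖star c • (y : A)‖ ≤ 1 := by
      rw [norm_smul, norm_star, hc1, one_mul]
      exact hy
    have := hsa ((1 / 2 : ℂ) • (star c • y + star (star c • y))) ?_ ?_
    · rwa [hz, Complex.ofReal_re] at this
    · refine Subtype.ext ?_
      change star ((1 / 2 : ℂ) • (star c • (y : A) + star (star c • (y : A)))) =
        (1 / 2 : ℂ) • (star c • (y : A) + star (star c • (y : A)))
      simp [add_comm]
    · change ‖(1 / 2 : ℂ) • (star c • (y : A) + star (star c • (y : A)))‖ ≤ 1
      rw [norm_smul]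
      have h2 := norm_add_le (star c • (y : A)) (star (star c • (y : A)))
      rw [norm_star] at h2
      have h3 : ‖(1 / 2 : ℂ)‖ = 1 / 2 := by norm_num
      rw [h3]
      linarith
  rcases (norm_nonneg x).eq_or_lt with h | h
  · simpa [← h] using hc x
  · have h1 := hball (((‖x‖⁻¹ : ℝ) : ℂ) • x) (by
      change ‖((‖x‖⁻¹ : ℝ) : ℂ) • (x : A)‖ ≤ 1
      rw [norm_smul, Complex.norm_real, norm_inv, norm_norm]
      exact (inv_mul_cancel₀ h.ne').le)
    rw [map_smul, norm_smul, Complex.norm_real, norm_inv, norm_norm, inv_mul_le_iff₀ h] at h1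
    linarith

/-- A functional with `‖f‖ ≤ Re f(1)` takes values with nonnegative real part on positive elements. -/
lemma re_apply_nonneg {f : StrongDual ℂ A} (hf : ‖f‖ ≤ (f 1).re) {a : A} (ha : 0 ≤ a) :
    0 ≤ (f a).re := by
  -- From `‖1 - b‖ ≤ 1` follows `Re f(1) - Re f(b) ≤ ‖f‖ ≤ Re f(1)`.
  have key : ∀ b : A, 0 ≤ b → ‖b‖ ≤ 1 → 0 ≤ (f b).re := fun b hb hb1 => by
    have hb1' : b ≤ 1 := (CStarAlgebra.norm_le_one_iff_of_nonneg b).mp hb1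
    have h1 : ‖1 - b‖ ≤ 1 := (CStarAlgebra.norm_le_one_iff_of_nonneg (1 - b)
      (sub_nonneg.mpr hb1')).mpr (sub_le_self 1 hb)
    have h2 := (Complex.re_le_norm _).trans ((f.le_opNorm (1 - b)).trans
      (mul_le_of_le_one_right (norm_nonneg f) h1))
    rw [map_sub, Complex.sub_re] at h2
    linarith
  rcases (norm_nonneg a).eq_or_lt with h | h
  · simp [norm_eq_zero.mp h.symm]
  · have h1 := key (‖a‖⁻¹ • a) (smul_nonneg (by positivity) ha)
      (by rw [norm_smul, norm_inv, norm_norm]; exact (inv_mul_cancel₀ h.ne').le)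
    rw [← Complex.coe_smul, map_smul, smul_eq_mul, Complex.re_ofReal_mul] at h1
    exact nonneg_of_mul_nonneg_right h1 (by positivity)

/-- `(2a - 1)² = 1 - 4(a - a²)`, and `a² ≤ a`. -/
lemma norm_two_smul_sub_one_le {a : A} (ha : 0 ≤ a) (ha1 : a ≤ 1) : ‖(2 : ℂ) • a - 1‖ ≤ 1 := by
  have hsq : a * a ≤ a := by simpa [sq] using CStarAlgebra.pow_antitone ha ha1 one_le_two
  have hstar : star ((2 : ℂ) • a - 1) = (2 : ℂ) • a - 1 := by
    simp [(IsSelfAdjoint.of_nonneg ha).star_eq]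
  have h0 := star_mul_self_nonneg ((2 : ℂ) • a - 1)
  have h1 : star ((2 : ℂ) • a - 1) * ((2 : ℂ) • a - 1) ≤ 1 := by
    have : star ((2 : ℂ) • a - 1) * ((2 : ℂ) • a - 1) = 1 - (4 : ℕ) • (a - a * a) := by
      rw [hstar, two_smul]
      noncomm_ring
    rw [this]
    exact sub_le_self _ (nsmul_nonneg (sub_nonneg.mpr hsq) 4)
  have h2 := (CStarAlgebra.norm_le_one_iff_of_nonneg _ h0).mpr h1
  rw [CStarRing.norm_star_mul_self] at h2
  nlinarith [norm_nonneg ((2 : ℂ) • a - 1)]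

variable {B : Type*} [CStarAlgebra B] [PartialOrder B] [StarOrderedRing B]

/-- Quasistates extend along isometric positive maps out of spaces whose selfadjoint unit ball is
approximated by differences of positive contractions. -/
theorem exists_mem_CCP_extension {V : SelfadjointOperatorSpace A} {W : SelfadjointOperatorSpace B}
    (hV : ∀ x : V, IsSelfAdjoint x → ‖x‖ ≤ 1 → x ∈ closure (V.posBall 1 - V.posBall 1))
    (ρ : V →ₗ[ℂ] W) (hnorm : ∀ x, ‖ρ x‖ = ‖x‖) (hstar : ∀ x, ρ (star x) = star (ρ x))
    (hpos : ∀ x : V, 0 ≤ (x : A) → 0 ≤ (ρ x : B)) {φ : V →ₗ[ℂ] ℂ} (hφ : φ ∈ CCP V ℂ) :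
    ∃ ψ ∈ CCP W ℂ, ∀ x, ψ (ρ x) = φ x := by
  obtain ⟨hc, hs, -⟩ := (mem_CCP_iff V φ).mp hφ
  let j : V →ₗ[ℂ] B := W.toSubmodule.subtype ∘ₗ ρ
  have hj : ∀ x, ‖j x‖ = ‖x‖ := hnorm
  have hinj : Function.Injective j := (injective_iff_map_eq_zero j).mpr fun x hx =>
    norm_eq_zero.mp (by rw [← hj, hx, norm_zero])
  let e := LinearEquiv.ofInjective j hinj
  have he : ∀ x, ‖e x‖ = ‖x‖ := hj
  let g : StrongDual ℂ (LinearMap.range j) := (φ ∘ₗ e.symm.toLinearMap).mkContinuous 1 fun y => by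
    rw [one_mul, ← e.apply_symm_apply y, he]
    simpa using hc (e.symm y)
  have hg : ∀ x, g (e x) = φ x := fun x => by simp [g]
  obtain ⟨f, hfg, hfn⟩ := exists_extension_norm_eq (𝕜 := ℂ) (LinearMap.range j) g
  have hf : ∀ x, f (j x) = φ x := fun x => (hfg (e x)).trans (hg x)
  have hf1 : ‖f‖ ≤ (f 1).re := by
    have hC : ∀ p ∈ V.posBall 1, (φ p).re ≤ (‖f‖ + (f 1).re) / 2 := fun p hp => by
      have hp0 : 0 ≤ j p := hpos p hp.1
      have hp1 : j p ≤ 1 := (CStarAlgebra.norm_le_one_iff_of_nonneg (j p)).mp ((hj p).trans_le hp.2)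
      have h1 := norm_two_smul_sub_one_le hp0 hp1
      have h2 := (Complex.re_le_norm _).trans ((f.le_opNorm _).trans
        (mul_le_of_le_one_right (norm_nonneg f) h1))
      rw [map_sub, map_smul, hf, smul_eq_mul, Complex.sub_re, Complex.mul_re] at h2
      norm_num at h2
      linarith
    have hC0 : 0 ≤ (‖f‖ + (f 1).re) / 2 := by
      simpa using hC 0 ⟨le_rfl, by simp⟩
    -- Since `‖g‖ = ‖f‖`, this bound by the average rearranges to `‖f‖ ≤ Re f(1)`.
    have : ‖g‖ ≤ (‖f‖ + (f 1).re) / 2 := g.opNorm_le_bound hC0 fun y => by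
      rw [← e.apply_symm_apply y, hg, he]
      exact norm_apply_le_of_forall_posBall hV hφ hC _
    linarith
  have hfle : ‖f‖ ≤ 1 := hfn.trans_le (LinearMap.mkContinuous_norm_le _ zero_le_one _)
  -- The hermitian part of `f`, restricted to `W`. It still extends `φ` because `φ` and `ρ` are
  -- hermitian, and on positive elements it equals `Re f`.
  let ψ : W →ₗ[ℂ] ℂ :=
    { toFun := fun y => (1 / 2) * (f (y : B) + star (f (star (y : B))))
      map_add' := fun y z => by
        change (1 / 2 : ℂ) * (f ((y : B) + z) + star (f (star ((y : B) + z)))) = _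
        simp only [star_add, map_add]
        ring
      map_smul' := fun c y => by
        change (1 / 2 : ℂ) * (f (c • (y : B)) + star (f (star (c • (y : B))))) = _
        simp only [star_smul, map_smul, smul_eq_mul, star_mul', star_star, RingHom.id_apply]
        ring }
  have hψ : ∀ y, ψ y = (1 / 2) * (f (y : B) + star (f (star (y : B)))) := fun _ => rfl
  refine ⟨ψ, (mem_CCP_iff W ψ).mpr ⟨fun y => ?_, fun y => ?_, fun y hy => ?_⟩, fun x => ?_⟩
  · have hb : ∀ b : B, ‖f b‖ ≤ ‖b‖ := fun b => f.le_of_opNorm_le_of_le hfle le_rfl |>.trans (by simp)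
    have h1 := norm_add_le (f (y : B)) (star (f (star (y : B))))
    rw [norm_star] at h1
    have h2 := hb y
    have h3 := hb (star (y : B))
    rw [norm_star] at h3
    rw [hψ, norm_mul]
    change _ ≤ ‖(y : B)‖
    have h4 : ‖(1 / 2 : ℂ)‖ = 1 / 2 := by norm_num
    rw [h4]
    linarith
  · rw [hψ, hψ]
    change (1 / 2 : ℂ) * (f (star (y : B)) + star (f (star (star (y : B))))) = _
    simp [add_comm]
  · have h := re_apply_nonneg hf1 hy
    have hre : ψ y = ((f (y : B)).re : ℂ) := by
      rw [hψ, (IsSelfAdjoint.of_nonneg hy).star_eq]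
      have := Complex.add_conj (f (y : B))
      rw [starRingEnd_apply] at this
      rw [this]
      push_cast
      ring
    rw [hre]
    exact_mod_cast h
  · have h : star (ρ x : B) = j (star x) := congrArg ((↑) : W → B) (hstar x).symm
    rw [hψ, h, hf, hs, star_star]
    change (1 / 2 : ℂ) * (f (j x) + φ x) = _
    rw [hf]
    ring

end SelfadjointOperatorSpace

/-! ### Amplifications and the unitisation. -/

namespace SelfadjointOperatorSpace

variable {A : Type*} [CStarAlgebra A] [PartialOrder A] [StarOrderedRing A]
  {B : Type*} [CStarAlgebra B] [PartialOrder B] [StarOrderedRing B]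
  {E : SelfadjointOperatorSpace A} {F : SelfadjointOperatorSpace B}

/-- The matrix over `E` underlying an element of `M_n(E)`. -/
def mat.toMatrix {n : ℕ} (x : E.mat n) : Matrix (Fin n) (Fin n) E :=
  fun i j => ⟨(x : CStarMatrix (Fin n) (Fin n) A) i j, x.2 i j⟩

/-- The amplification `θ⁽ⁿ⁾ : M_n(E) → M_n(F)`. -/
noncomputable def amplification (θ : E →ₗ[ℂ] F) (n : ℕ) : E.mat n →ₗ[ℂ] F.mat n where
  toFun x := ⟨CStarMatrix.ofMatrix fun i j => (θ (mat.toMatrix x i j) : B),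
    fun _ _ => SetLike.coe_mem _⟩
  map_add' x y := Subtype.ext <| by
    ext i j
    exact congrArg ((↑) : F → B) (θ.map_add (mat.toMatrix x i j) (mat.toMatrix y i j))
  map_smul' c x := Subtype.ext <| by
    ext i j
    exact congrArg ((↑) : F → B) (θ.map_smul c (mat.toMatrix x i j))

/-- Transfers the elements `a_ε^{-1/2} x a_ε^{-1/2}` that test positivity in `E^#` to those for
`F^#`; the scalar part `a` is untouched by `θ^#`. -/
lemma amplification_scalarMul (θ : E →ₗ[ℂ] F) {n : ℕ} (α β : CStarMatrix (Fin n) (Fin n) ℂ)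
    (x : Matrix (Fin n) (Fin n) E) :
    amplification θ n (E.scalarMul α x β) = F.scalarMul α (x.map θ) β := by
  refine Subtype.ext ?_
  ext i j
  refine congrArg ((↑) : F → B) (?_ : θ (∑ k, ∑ l, (α i k * β l j) • x k l) =
    ∑ k, ∑ l, (α i k * β l j) • θ (x k l))
  simp [map_sum]

lemma norm_amplification {θ : E →ₗ[ℂ] F} (hθ : IsCompletelyIsometric θ) {n : ℕ} (x : E.mat n) :
    ‖amplification θ n x‖ = ‖x‖ :=
  hθ n (mat.toMatrix x)

lemma amplification_star {θ : E →ₗ[ℂ] F} (hθ : IsCompletelyPositive θ) {n : ℕ} (x : E.mat n) :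
    amplification θ n (star x) = star (amplification θ n x) := by
  refine Subtype.ext ?_
  ext i j
  exact congrArg ((↑) : F → B) (congrFun (congrFun ((hθ n).1 (mat.toMatrix x)) i) j)

lemma amplification_nonneg {θ : E →ₗ[ℂ] F} (hθ : IsCompletelyPositive θ) {n : ℕ} (x : E.mat n)
    (hx : 0 ≤ (x : CStarMatrix (Fin n) (Fin n) A)) :
    0 ≤ (amplification θ n x : CStarMatrix (Fin n) (Fin n) B) :=
  (hθ n).2 (mat.toMatrix x) hx

lemma comp_amplification_mem_CCP {θ : E →ₗ[ℂ] F} (hi : IsCompletelyIsometric θ)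
    (hp : IsCompletelyPositive θ) {n : ℕ} {ψ : F.mat n →ₗ[ℂ] ℂ} (hψ : ψ ∈ CCP (F.mat n) ℂ) :
    ψ ∘ₗ amplification θ n ∈ CCP (E.mat n) ℂ := by
  obtain ⟨h1, h2, h3⟩ := (mem_CCP_iff _ ψ).mp hψ
  refine (mem_CCP_iff _ _).mpr ⟨fun x => ?_, fun x => ?_, fun x hx => ?_⟩
  · exact (h1 _).trans_eq (norm_amplification hi x)
  · rw [LinearMap.comp_apply, amplification_star hp, h2, LinearMap.comp_apply]
  · exact h3 _ (amplification_nonneg hp x hx)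

omit [PartialOrder A] [StarOrderedRing A] [PartialOrder B] [StarOrderedRing B] in
lemma map_unitisationMap_conjTranspose {θ : E →ₗ[ℂ] F} (hθ : ∀ x, θ (star x) = star (θ x)) {n : ℕ}
    (X : Matrix (Fin n) (Fin n) E.Unitisation) :
    X.conjTranspose.map (unitisationMap θ) = (X.map (unitisationMap θ)).conjTranspose := by
  refine Matrix.ext fun i j => ?_
  exact Prod.ext (hθ (X j i).1) rfl

omit [PartialOrder A] [StarOrderedRing A] [PartialOrder B] [StarOrderedRing B] in
lemma unitisationMap_injective {θ : E →ₗ[ℂ] F} (hθ : Function.Injective θ) :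
    Function.Injective (unitisationMap θ) :=
  hθ.prodMap Function.injective_id

/-- If every quasistate of every `M_n(E)` extends along `θ`, then `θ` is an embedding. -/
theorem isEmbedding_of_extension {θ : E →ₗ[ℂ] F} (hi : IsCompletelyIsometric θ)
    (ho : IsCompleteOrderEmbedding θ)
    (hext : ∀ (n : ℕ), ∀ φ ∈ CCP (E.mat n) ℂ, ∃ ψ ∈ CCP (F.mat n) ℂ,
      ∀ x, ψ (amplification θ n x) = φ x) : IsEmbedding θ := by
  have hstar : ∀ x, θ (star x) = star (θ x) := fun x =>
    congrFun (congrFun ((ho.1 1).1 (Matrix.of fun _ _ => x)) 0) 0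
  have hinj := unitisationMap_injective ho.2.1
  refine ⟨hi, ho, Prod.ext (map_zero θ) rfl, fun n => ⟨map_unitisationMap_conjTranspose hstar, ?_⟩,
    hinj, fun n X => ?_⟩
  · rintro X ⟨hX, ha, hx⟩
    refine ⟨?_, ha, fun ε hε ψ hψ => ?_⟩
    · rw [Matrix.IsHermitian, ← map_unitisationMap_conjTranspose hstar, hX.eq]
    · have h := hx ε hε _ (comp_amplification_mem_CCP hi ho.1 hψ)
      rw [LinearMap.comp_apply, amplification_scalarMul] at h
      exact h
  · rintro ⟨hX, ha, hx⟩
    refine ⟨?_, ha, fun ε hε φ hφ => ?_⟩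
    · rw [Matrix.IsHermitian, ← map_unitisationMap_conjTranspose hstar] at hX
      exact Matrix.map_injective hinj hX
    -- The hypothesis controls only quasistates of `M_n(F)`, so `φ` is replaced by its extension.
    · obtain ⟨ψ, hψ, hψφ⟩ := hext n φ hφ
      have h := hx ε hε ψ hψ
      rw [← hψφ, amplification_scalarMul]
      exact h

end SelfadjointOperatorSpace

theorem theorem4p14 {H : Type u} [NormedAddCommGroup H] [InnerProductSpace ℂ H]
    [CompleteSpace H] (E : SelfadjointOperatorSpace (H →L[ℂ] H))
    (hE : E.IsCompletelyApproximatelyGenerated 1) :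
    SelfadjointOperatorSpace.AutomaticEmbeddingProperty.{u, v} E := by
  intro K _ _ _ F θ hi ho
  exact SelfadjointOperatorSpace.isEmbedding_of_extension hi ho fun n φ hφ =>
    SelfadjointOperatorSpace.exists_mem_CCP_extension (hE n)
      (SelfadjointOperatorSpace.amplification θ n)
      (SelfadjointOperatorSpace.norm_amplification hi)
      (SelfadjointOperatorSpace.amplification_star ho.1)
      (SelfadjointOperatorSpace.amplification_nonneg ho.1) hφ
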